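/- For $n=2^t$ ($t\ge 0$) let $\zeta_n=e^{2\pi i/n}$ and $$\vartheta_n:=\frac1{\varphi(n)}\Big(1+\frac12\sum_{\chi\ne\chi_0}\tau(\chi)\Big),$$ where $\chi$ runs through the non-trivial Dirichlet characters mod $n$ and $\tau(\chi)=\sum_{s\in(\mathbb Z/f_\chi)^\times}\chi(s)\zeta_{f_\chi}^s$ is the Gauss sum of the primitive character (of conductor $f_\chi$) attached to $\chi$. Let $\mathrm{Sp}$ denote the trace of $\mathbb Q(\zeta_n)/\mathbb Q$ and, for a normal basis generator $\vartheta$ of $\mathbb Q(\zeta_n)/\mathbb Q$, let $\vartheta^*$ be the generator of the dual basis, $\mathrm{Sp}(\vartheta^{*\sigma}\vartheta^{\varrho})=\delta_{\sigma,\varrho}$. The transform $\mathrm{ADFT}_{n,\vartheta}:\mathbb Q^n\to\mathbb Q^n$ has matrix $A_{n,\vartheta}=(\mathrm{Sp}(\vartheta^*\zeta_n^{kl}))_{0\le k,l<n}$. For even $n$ put $N_n=(\mathrm{Sp}(\vartheta_n^{*\sigma}\zeta_n^l))_{l,\sigma}$ with $0\le l<n/2$ and $\sigma\in\mathrm{Gal}(\mathbb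 Q(\zeta_n)/\mathbb Q)$, the columns being ordered by $\sigma=\sigma_s:\zeta_n\mapsto\zeta_n^s$, $s=1,3,\dots,n-1$. Write $A_n:=A_{n,\vartheta_n}$ and let $E_m$ be the identity matrix of size $m$. **Theorem.** For every $n=2^t$ the element $\vartheta_n$ lies in $\mathbb Q(\zeta_n)$ and generates a slim normal basis of $\mathbb Q(\zeta_n)/\mathbb Q$, that is, a normal basis with $\mathrm{Sp}(\vartheta_n^*\zeta_n^s)\in\{0,\pm1\}$ for all $s\in\mathbb Z$. Moreover: 1. For $n=2^t\ge2$, taking the columns of $A_n$ in the order $0,2,\dots,n-2$, then $1,3^{-1},\dots,(n-1)^{-1}$ (inverses mod $n$), gives $$\tilde A_n=(A_2\otimes E_{n/2})\begin{pmatrix}A_{n/2}&\\&N_n\end{pmatrix}.$$ 2. For $n=2^t\ge4$, taking the even rows $0,2,\dots$ of $N_n$ first and then the odd rows gives $$\tilde N_n=\begin{pmatrix}N_{n/2}&\\&E_{n/4}\end{pmatrix}(A_2\otimes E_{n/4}).$$ 3. Consider the recursive algorithms given by these factorisations, written as straight-line programs over $\mathbb Q$ whose only arithmetic operations are additions and subtractions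 of two previously computed numbers (re-indexing and copying is free, $A_2\otimes E_m$ is carried out by the $2m$ operations $(a_i,b_i)\mapsto(a_i+b_i,a_i-b_i)$, and the recursions start from $A_1=N_2=(1)$, at no cost). For every $n=2^t$ the algorithm for $A_n$ computes $\mathrm{ADFT}_{n,\vartheta_n}(c)$ for all $c\in\mathbb Q^n$, and for every $n=2^t\ge 2$ the algorithm for $N_n$ computes $N_n c$ for all $c\in\mathbb Q^{n/2}$. 4. Let $\Upsilon_A(n)$ and $\Upsilon_N(n)$ be the numbers of additions (each subtraction counted as one addition) used by these algorithms. Then $\Upsilon_N(n)=\Upsilon_N(n/2)+n/2$ for $n\ge4$, $\Upsilon_N(n)\le n-2$ and $\Upsilon_A(n)=\Upsilon_A(n/2)+\Upsilon_N(n)+n$ for $n\ge2$, and $\Upsilon_A(n)\in O(n)$: there is a constant $C$ with $\Upsilon_A(n)\le Cn$ for every $n=2^t$, $t\ge0$. -/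

import Mathlib

open scoped IntermediateField Kronecker

namespace SlimADFT

/-! ## Cyclotomic fields inside `ℂ`, normal bases, slim bases -/

/-- `ζ_n = exp (2πi / n)`. -/
noncomputable def zeta (n : ℕ) : ℂ := Complex.exp (2 * Real.pi * Complex.I / n)

/-- The cyclotomic field `ℚ(ζ_n)`, as a subfield of `ℂ`. -/
noncomputable abbrev Cyc (n : ℕ) : IntermediateField ℚ ℂ := ℚ⟮zeta n⟯

/-- `ζ_n` as an element of `ℚ(ζ_n)`. -/
noncomputable def zetaC (n : ℕ) : Cyc n := IntermediateField.AdjoinSimple.gen ℚ (zeta n)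

theorem isIntegral_zeta (n : ℕ) : IsIntegral ℚ (zeta n) := by
  rcases Nat.eq_zero_or_pos n with rfl | hn
  · have h : zeta 0 = 1 := by simp [zeta]
    rw [h]
    exact isIntegral_one
  · have h : zeta n ^ n = 1 := (Complex.isPrimitiveRoot_exp n hn.ne').pow_eq_one
    exact IsIntegral.of_pow hn (h ▸ isIntegral_one)

instance finiteDimensional_cyc (n : ℕ) : FiniteDimensional ℚ (Cyc n) :=
  IntermediateField.adjoin.finiteDimensional (isIntegral_zeta n)

/-- The Galois group of `ℚ(ζ_n)/ℚ`. -/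
abbrev GalCyc (n : ℕ) : Type := Cyc n ≃ₐ[ℚ] Cyc n

/-- `θ` is a normal basis generator of `ℚ(ζ_n)/ℚ`: its conjugates form a `ℚ`-basis. -/
def IsNBG {n : ℕ} (θ : Cyc n) : Prop :=
  LinearIndependent ℚ (fun σ : GalCyc n => σ θ) ∧
    ⊤ ≤ Submodule.span ℚ (Set.range fun σ : GalCyc n => σ θ)

/-- The normal basis `(θ^σ)_σ`. -/
noncomputable def normalBasis {n : ℕ} (θ : Cyc n) (hθ : IsNBG θ) :
    Module.Basis (GalCyc n) ℚ (Cyc n) :=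
  Module.Basis.mk hθ.1 hθ.2

open Classical in
/-- The generator `θ*` of the dual basis with respect to the trace form. -/
noncomputable def dualGen {n : ℕ} (θ : Cyc n) (hθ : IsNBG θ) : Cyc n :=
  (Algebra.traceForm ℚ (Cyc n)).dualBasis (traceForm_nondegenerate ℚ (Cyc n))
    (normalBasis θ hθ) 1

open Classical in
/-- The defining property of `θ*`: `Sp (θ*^σ θ^ρ) = δ_{σ,ρ}`. -/
theorem trace_dualGen {n : ℕ} (θ : Cyc n) (hθ : IsNBG θ) (σ ρ : GalCyc n) :
    Algebra.trace ℚ (Cyc n) (σ (dualGen θ hθ) * ρ θ) = if σ = ρ then 1 else 0 := by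
  have h1 : σ (dualGen θ hθ) * ρ θ = σ (dualGen θ hθ * (σ⁻¹ * ρ) θ) := by
    rw [map_mul]
    congr 1
    simp [AlgEquiv.mul_apply]
  rw [h1, Algebra.trace_eq_of_algEquiv σ]
  have h2 := LinearMap.BilinForm.apply_dualBasis_left (B := Algebra.traceForm ℚ (Cyc n))
    (traceForm_nondegenerate ℚ (Cyc n)) (normalBasis θ hθ) 1 (σ⁻¹ * ρ)
  have h3 : normalBasis θ hθ (σ⁻¹ * ρ) = (σ⁻¹ * ρ) θ := by simp [normalBasis]
  rw [h3, Algebra.traceForm_apply] at h2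
  refine h2.trans ?_
  simp only [inv_mul_eq_one]

/-- The normal basis generated by `θ` is slim: `Sp (θ* ζ_n^s) ∈ {0, 1, -1}` for all `s ∈ ℤ`. -/
def IsSlim {n : ℕ} (θ : Cyc n) (hθ : IsNBG θ) : Prop :=
  ∀ s : ℤ, Algebra.trace ℚ (Cyc n) (dualGen θ hθ * zetaC n ^ s) ∈ ({0, 1, -1} : Set ℚ)

/-! ## The transform and its matrices -/

/-- The matrix `A_{n,θ} = (Sp (θ* ζ_n^{kl}))_{k,l}`, `0 ≤ k, l < n`. -/
noncomputable def matA {n : ℕ} (θ : Cyc n) (hθ : IsNBG θ) : Matrix (Fin n) (Fin n) ℚ :=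
  Matrix.of fun k l =>
    Algebra.trace ℚ (Cyc n) (dualGen θ hθ * zetaC n ^ ((k : ℕ) * (l : ℕ)))

/-- The transform `ADFT_{n,θ} : ℚ^n → ℚ^n`. -/
noncomputable def adft {n : ℕ} (θ : Cyc n) (hθ : IsNBG θ) :
    (Fin n → ℚ) →ₗ[ℚ] (Fin n → ℚ) :=
  Matrix.toLin' (matA θ hθ)

/-- The matrix `N_{n,θ} = (Sp (θ*^σ ζ_n^l))_{l,σ}`, `0 ≤ l < n / 2`, for `n = 2 ^ (t + 1)`
(so that `n / 2 = 2 ^ t`). -/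
noncomputable def matN {t : ℕ} (θ : Cyc (2 ^ (t + 1))) (hθ : IsNBG θ) :
    Matrix (Fin (2 ^ t)) (GalCyc (2 ^ (t + 1))) ℚ :=
  Matrix.of fun l σ =>
    Algebra.trace ℚ (Cyc (2 ^ (t + 1))) (σ (dualGen θ hθ) * zetaC (2 ^ (t + 1)) ^ (l : ℕ))

/-! ## The generator `ϑ_n` -/

/-- The Gauss sum `τ(χ) = ∑_s χ(s) ζ_f^s` of the primitive character inducing `χ`, where `f` is
the conductor of `χ` and `s` runs through `ℤ/f` (non-units contribute `0`);
`ZMod.stdAddChar s = exp (2πi s / f)`. -/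
noncomputable def tau {n : ℕ} [NeZero n] (χ : DirichletCharacter ℂ n) : ℂ :=
  haveI : NeZero χ.conductor := ⟨χ.conductor_ne_zero⟩
  gaussSum χ.primitiveCharacter ZMod.stdAddChar

open Classical in
/-- `ϑ_n = (1 / φ(n)) (1 + (1/2) ∑_{χ ≠ χ₀} τ(χ))`, where `χ` runs through the non-trivial
Dirichlet characters mod `n`. -/
noncomputable def slimGen (n : ℕ) [NeZero n] : ℂ :=
  1 / (n.totient : ℂ) *
    (1 + 1 / 2 * ∑ χ ∈ (Finset.univ : Finset (DirichletCharacter ℂ n)).erase 1, tau χ)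

/-! ## Index permutations -/

/-- First half and second half of `{0, …, n-1}`, `n = 2 ^ (t + 1)`:
`inl k ↦ k`, `inr k ↦ n/2 + k`. -/
def halves (t : ℕ) : Fin (2 ^ t) ⊕ Fin (2 ^ t) ≃ Fin (2 ^ (t + 1)) :=
  finSumFinEquiv.trans (finCongr (by rw [pow_succ, mul_two]))

/-- Even numbers first, then odd numbers: `inl j ↦ 2 j`, `inr j ↦ 2 j + 1`. -/
def evenOdd (t : ℕ) : Fin (2 ^ t) ⊕ Fin (2 ^ t) ≃ Fin (2 ^ (t + 1)) where
  toFun := Sum.elim (fun j => ⟨2 * j, by have := j.isLt; rw [pow_succ]; omega⟩)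
    (fun j => ⟨2 * j + 1, by have := j.isLt; rw [pow_succ]; omega⟩)
  invFun l :=
    if (l : ℕ) % 2 = 0 then
      Sum.inl ⟨(l : ℕ) / 2, by have := l.isLt; have := pow_succ 2 t; omega⟩
    else
      Sum.inr ⟨(l : ℕ) / 2, by have := l.isLt; have := pow_succ 2 t; omega⟩
  left_inv x := by
    rcases x with j | j
    · simp
    · have h1 : (2 * (j : ℕ) + 1) % 2 ≠ 0 := by omega
      have h2 : (2 * (j : ℕ) + 1) / 2 = j := by omega
      simp [h2]
  right_inv l := by
    by_cases h : (l : ℕ) % 2 = 0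
    · simp only [h, if_true, Sum.elim_inl, Fin.ext_iff]; omega
    · simp only [h, if_false, Sum.elim_inr, Fin.ext_iff]; omega

/-- The column order for `A_n`, `n = 2 ^ (t + 1)`: first the even columns `0, 2, …, n - 2`, then
the columns `1, 3⁻¹, …, (n - 1)⁻¹` (inverses mod `n`). -/
def colIndex (t : ℕ) : Fin (2 ^ t) ⊕ Fin (2 ^ t) → Fin (2 ^ (t + 1)) :=
  Sum.elim (fun j => evenOdd t (Sum.inl j))
    (fun j => ⟨(((2 * (j : ℕ) + 1 : ℕ) : ZMod (2 ^ (t + 1)))⁻¹).val, ZMod.val_lt _⟩)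

theorem colIndex_bijective (t : ℕ) : Function.Bijective (colIndex t) := by
  have hcop : ∀ j : ℕ, Nat.Coprime (2 * j + 1) (2 ^ (t + 1)) := fun j =>
    Nat.Coprime.pow_right _ (by simp)
  have key : ∀ j : ℕ, ((2 * j + 1 : ℕ) : ZMod (2 ^ (t + 1))) *
      ((2 * j + 1 : ℕ) : ZMod (2 ^ (t + 1)))⁻¹ = 1 := fun j =>
    ZMod.coe_mul_inv_eq_one _ (hcop j)
  have hodd : ∀ j : ℕ, (((2 * j + 1 : ℕ) : ZMod (2 ^ (t + 1)))⁻¹).val % 2 = 1 := by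
    intro j
    have hu : IsUnit ((((2 * j + 1 : ℕ) : ZMod (2 ^ (t + 1)))⁻¹).val : ZMod (2 ^ (t + 1))) := by
      rw [ZMod.natCast_zmod_val]
      exact IsUnit.of_mul_eq_one _ (by rw [mul_comm]; exact key j)
    rw [ZMod.isUnit_iff_coprime] at hu
    have h2 : Nat.Coprime _ 2 := Nat.Coprime.coprime_dvd_right (dvd_pow_self 2 (Nat.succ_ne_zero t)) hu
    exact Nat.odd_iff.mp (Nat.coprime_two_right.mp h2)
  rw [Fintype.bijective_iff_injective_and_card]
  refine ⟨?_, by simp [pow_succ, mul_two]⟩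
  rintro (i | i) (j | j) h
  · simp only [colIndex, Sum.elim_inl, EmbeddingLike.apply_eq_iff_eq] at h
    exact h
  · exfalso
    have h' := congrArg Fin.val h
    have := hodd j
    simp only [colIndex, evenOdd, Equiv.coe_fn_mk, Sum.elim_inl, Sum.elim_inr] at h'
    omega
  · exfalso
    have h' := congrArg Fin.val h
    have := hodd i
    simp only [colIndex, evenOdd, Equiv.coe_fn_mk, Sum.elim_inl, Sum.elim_inr] at h'
    omega
  · have h' := congrArg Fin.val h
    simp only [colIndex, Sum.elim_inr] at h'
    have h1 := ZMod.val_injective _ h'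
    have h2 : ((2 * (i : ℕ) + 1 : ℕ) : ZMod (2 ^ (t + 1))) = ((2 * (j : ℕ) + 1 : ℕ) : ZMod _) := by
      calc ((2 * (i : ℕ) + 1 : ℕ) : ZMod (2 ^ (t + 1)))
          = ((2 * (i : ℕ) + 1 : ℕ) : ZMod (2 ^ (t + 1))) *
              (((2 * (j : ℕ) + 1 : ℕ) : ZMod (2 ^ (t + 1))) *
                ((2 * (j : ℕ) + 1 : ℕ) : ZMod (2 ^ (t + 1)))⁻¹) := by rw [key, mul_one]
        _ = ((2 * (j : ℕ) + 1 : ℕ) : ZMod (2 ^ (t + 1))) *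
              (((2 * (i : ℕ) + 1 : ℕ) : ZMod (2 ^ (t + 1))) *
                ((2 * (i : ℕ) + 1 : ℕ) : ZMod (2 ^ (t + 1)))⁻¹) := by rw [h1]; ring
        _ = _ := by rw [key, mul_one]
    rw [ZMod.natCast_eq_natCast_iff', Nat.mod_eq_of_lt, Nat.mod_eq_of_lt] at h2
    · exact congrArg Sum.inr (Fin.ext (by omega))
    · have := j.isLt; rw [pow_succ]; omega
    · have := i.isLt; rw [pow_succ]; omega

/-- `colIndex` as a permutation of indices. -/
noncomputable def colOrder (t : ℕ) : Fin (2 ^ t) ⊕ Fin (2 ^ t) ≃ Fin (2 ^ (t + 1)) :=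
  Equiv.ofBijective (colIndex t) (colIndex_bijective t)

/-- The Kronecker product `M ⊗ E_m` of a `2 × 2` matrix with the identity matrix of size `m`,
its `2 m` indices written as two blocks of length `m`. -/
noncomputable def kronId (M : Matrix (Fin 2) (Fin 2) ℚ) (m : ℕ) :
    Matrix (Fin m ⊕ Fin m) (Fin m ⊕ Fin m) ℚ :=
  let e : Fin 2 × Fin m ≃ Fin m ⊕ Fin m :=
    (Equiv.prodCongr finTwoEquiv (Equiv.refl _)).trans (Equiv.boolProdEquivSum (Fin m))
  Matrix.reindex e e (M ⊗ₖ (1 : Matrix (Fin m) (Fin m) ℚ))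

/-! ## Addition networks: straight-line programs whose only operations are `±` -/

/-- One output of a layer: a copy of an input (free), or the sum or the difference of two
inputs (one addition each). -/
inductive Gate (ι : Type) : Type
  | copy (i : ι) : Gate ι
  | add (i j : ι) : Gate ι
  | sub (i j : ι) : Gate ι

/-- The value of a gate on the input `x`. -/
def Gate.eval {ι : Type} (x : ι → ℚ) : Gate ι → ℚ
  | .copy i => x i
  | .add i j => x i + x j
  | .sub i j => x i - x j

/-- The number of additions in `ℚ` made by a gate. -/
def Gate.cost {ι : Type} : Gate ι → ℕ
  | .copy _ => 0
  | .add _ _ => 1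
  | .sub _ _ => 1

/-- Addition networks with inputs indexed by the first type and outputs by the second one. -/
inductive Net : Type → Type → Type 1
  | layer {ι κ : Type} [Fintype κ] (g : κ → Gate ι) : Net ι κ
  | seq {ι κ μ : Type} (P : Net ι κ) (Q : Net κ μ) : Net ι μ
  | par {ι κ ι' κ' : Type} (P : Net ι κ) (Q : Net ι' κ') : Net (ι ⊕ ι') (κ ⊕ κ')

/-- The output of a network: `seq P Q` runs `P` and then `Q`, and `par P Q` runs `P` and `Q` on
separate inputs. -/
def Net.run : {ι κ : Type} → Net ι κ → (ι → ℚ) → (κ → ℚ)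
  | _, _, @Net.layer _ _ _ g, x => fun k => (g k).eval x
  | _, _, .seq P Q, x => Q.run (P.run x)
  | _, _, .par P Q, x => Sum.elim (P.run (x ∘ Sum.inl)) (Q.run (x ∘ Sum.inr))

/-- The number of additions in `ℚ` made by a network. -/
def Net.cost : {ι κ : Type} → Net ι κ → ℕ
  | _, _, @Net.layer _ _ _ g => ∑ k, (g k).cost
  | _, _, .seq P Q => P.cost + Q.cost
  | _, _, .par P Q => P.cost + Q.cost

/-- The network that re-indexes its inputs along `f`, without any operation. -/
def Net.wires {ι κ : Type} [Fintype κ] (f : κ → ι) : Net ι κ :=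
  .layer fun k : κ => .copy (f k)

/-- The network for `A_2 ⊗ E_m`: `(a, b) ↦ (a + b, a - b)` for vectors `a, b` of length `m`. -/
def Net.butterfly (m : ℕ) : Net (Fin m ⊕ Fin m) (Fin m ⊕ Fin m) :=
  .layer (κ := Fin m ⊕ Fin m)
    (Sum.elim (fun i => .add (.inl i) (.inr i)) (fun i => .sub (.inl i) (.inr i)))

/-- The algorithm for `N_n`, `n = 2 ^ (t + 1)`, from the recursive factorisation
`(N_{n/2} ⊕ E_{n/4}) (A_2 ⊗ E_{n/4})` of `N_n` with permuted rows. The `j`-th input belongs to the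
automorphism `ζ_n ↦ ζ_n ^ (2 j + 1)`. -/
def netN : (t : ℕ) → Net (Fin (2 ^ t)) (Fin (2 ^ t))
  | 0 => .wires id
  | t + 1 =>
    .seq (.wires (halves t)) <|
    .seq (.butterfly (2 ^ t)) <|
    .seq (.par (netN t) (.wires id)) <|
    .wires (evenOdd t).symm

/-- The algorithm for `ADFT_n`, `n = 2 ^ t`, from the recursive factorisation
`(A_2 ⊗ E_{n/2}) (A_{n/2} ⊕ N_n)` of `A_n` with permuted columns. -/
def netA : (t : ℕ) → Net (Fin (2 ^ t)) (Fin (2 ^ t))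
  | 0 => .wires id
  | t + 1 =>
    .seq (.wires (colIndex t)) <|
    .seq (.par (netA t) (netN t)) <|
    .seq (.butterfly (2 ^ t)) <|
    .wires (halves t).symm

end SlimADFT

namespace SlimADFT


/-! ## Coordinates of roots of unity: arithmetic -/

/-! Everything is reduced to the integer function `slimCoord t m`, the value of `Sp (ϑ* ζ ^ m)`. Let
`n = 2 ^ (t + 1)`. Summing Gauss sums over all characters gives `ϑ_n` explicitly as `2^{-t} (1 + ∑
2^{t-1-i} ζ^{2^i})`, `i < t` (`coe_slimElt`). The dual element is guessed as `2^{-t} (1 + ∑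
ζ^{-2^i})`. Traces of roots of unity of order `2 ^ k` vanish unless the root is `±1`, so every
pairing with the guess is a short sum of values of `normTrace`. The resulting orthogonality relation
(`slimCoord_duality`) proves both that `ϑ_n` generates a normal basis and that the guess is its
dual.

Two rules govern `slimCoord`: at an even exponent it is the function for `n / 2` at half the
exponent, and for `n ≥ 4` at an odd exponent it is the single term `normTrace (m - 1)`. Slimness
follows at once. Since `A_n` has entries `slimCoord (k l)` and `N_n` has entries `slimCoord (s⁻¹
l)`, the same rules, with periodicity mod `n` and the sign change under `m ↦ m + n / 2`, give both
factorisations. Correctness and cost of the networks are then inductions on `t`. -/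

/-- The trace of `ζ ^ m`, divided by the degree, for `ζ = ζ_n` with `n = 2 ^ (t + 1)`. -/
def normTrace (t : ℕ) (m : ℤ) : ℚ :=
  if (2 : ℤ) ^ (t + 1) ∣ m then 1 else if (2 : ℤ) ^ t ∣ m then -1 else 0

theorem two_pow_succ_dvd_two_mul (t : ℕ) (m : ℤ) : (2 : ℤ) ^ (t + 1) ∣ 2 * m ↔ (2 : ℤ) ^ t ∣ m := by
  rw [pow_succ, mul_comm]
  exact mul_dvd_mul_iff_left two_ne_zero

theorem normTrace_zero (t : ℕ) : normTrace t 0 = 1 := by simp [normTrace]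

theorem normTrace_succ_two_mul (t : ℕ) (m : ℤ) : normTrace (t + 1) (2 * m) = normTrace t m := by
  simp only [normTrace, two_pow_succ_dvd_two_mul]

theorem normTrace_succ_of_odd (t : ℕ) {m : ℤ} (hm : Odd m) : normTrace (t + 1) m = 0 := by
  have h : ∀ s : ℕ, ¬ (2 : ℤ) ^ (s + 1) ∣ m := fun s hs =>
    (Int.not_even_iff_odd.mpr hm) (even_iff_two_dvd.mpr ((dvd_pow_self 2 s.succ_ne_zero).trans hs))
  simp [normTrace, h]

theorem normTrace_congr (t : ℕ) {m m' : ℤ} (h : (2 : ℤ) ^ (t + 1) ∣ m - m') :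
    normTrace t m = normTrace t m' := by
  have h' : (2 : ℤ) ^ t ∣ m - m' := (pow_dvd_pow 2 t.le_succ).trans h
  simp only [normTrace, (dvd_iff_dvd_of_dvd_sub h), (dvd_iff_dvd_of_dvd_sub h')]

/-- This mirrors `ζ ^ (n / 2) = -1`. If `2 ^ t` divides `m`, the shift flips the parity of the
quotient. -/
theorem normTrace_add_half (t : ℕ) (m : ℤ) : normTrace t (m + 2 ^ t) = -normTrace t m := by
  have h1 : (2 : ℤ) ^ t ∣ m + 2 ^ t ↔ (2 : ℤ) ^ t ∣ m := dvd_add_self_right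
  have hp : (2 : ℤ) ^ t ≠ 0 := by positivity
  by_cases h : (2 : ℤ) ^ t ∣ m
  · obtain ⟨k, rfl⟩ := h
    have h2 : (2 : ℤ) ^ (t + 1) ∣ 2 ^ t * k ↔ 2 ∣ k := by
      rw [pow_succ]; exact mul_dvd_mul_iff_left hp
    have h3 : (2 : ℤ) ^ (t + 1) ∣ 2 ^ t * k + 2 ^ t ↔ 2 ∣ k + 1 := by
      rw [pow_succ, show (2 : ℤ) ^ t * k + 2 ^ t = 2 ^ t * (k + 1) by ring]
      exact mul_dvd_mul_iff_left hp
    simp only [normTrace, h2, h3, h1, dvd_mul_right, if_true]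
    rcases Int.even_or_odd' k with ⟨l, rfl | rfl⟩
    · have : ¬ (2 : ℤ) ∣ 2 * l + 1 := by omega
      simp [this]
    · have : ¬ (2 : ℤ) ∣ 2 * l + 1 := by omega
      have h' : (2 : ℤ) ∣ 2 * l + 1 + 1 := by omega
      simp [this, h']
  · have h2 : ∀ k : ℤ, ¬ (2 : ℤ) ^ t ∣ k → ¬ (2 : ℤ) ^ (t + 1) ∣ k := fun k hk hk' =>
      hk ((pow_dvd_pow 2 t.le_succ).trans hk')
    simp [normTrace, h, h1, h2 m h, h2 (m + 2 ^ t) (by rwa [h1])]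

/-- The coordinate of `ζ ^ m` at `ϑ_n` in the slim normal basis, for `n = 2 ^ t`. -/
def slimCoord : ℕ → ℤ → ℚ
  | 0, _ => 1
  | t + 1, m => normTrace t m + ∑ i ∈ Finset.range t, normTrace t (m - 2 ^ i)

theorem slimCoord_one (m : ℤ) : slimCoord 1 m = if 2 ∣ m then 1 else -1 := by
  simp [slimCoord, normTrace]

/-- The shift by `2 ^ 0` makes the exponent odd and contributes nothing; all other exponents are
even and can be halved. -/
theorem slimCoord_succ_two_mul (t : ℕ) (m : ℤ) : slimCoord (t + 1) (2 * m) = slimCoord t m := by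
  cases t with
  | zero => rw [slimCoord_one]; simp [slimCoord]
  | succ t =>
    have h0 : normTrace (t + 1) (2 * m - 2 ^ 0) = 0 :=
      normTrace_succ_of_odd t ⟨m - 1, by ring⟩
    have h1 : ∀ i : ℕ, normTrace (t + 1) (2 * m - 2 ^ (i + 1)) = normTrace t (m - 2 ^ i) :=
      fun i => by rw [← normTrace_succ_two_mul t (m - 2 ^ i)]; congr 1; ring
    simp only [slimCoord, Finset.sum_range_succ', h0, h1, add_zero, normTrace_succ_two_mul]

/-- For odd `m` only the shift by `2 ^ 0` reaches an even exponent. The level must be at least 4: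
for `n = 2` the sum has no shifts. -/
theorem slimCoord_of_odd (t : ℕ) {m : ℤ} (hm : Odd m) :
    slimCoord (t + 2) m = normTrace (t + 1) (m - 1) := by
  have h1 : ∀ i : ℕ, normTrace (t + 1) (m - 2 ^ (i + 1)) = 0 := fun i =>
    normTrace_succ_of_odd t (hm.sub_even ⟨2 ^ i, by ring⟩)
  simp [slimCoord, Finset.sum_range_succ', h1, normTrace_succ_of_odd t hm]

theorem slimCoord_zero_right (t : ℕ) : slimCoord t 0 = 1 := by
  induction t with
  | zero => rfl
  | succ t ih => rw [← ih, ← slimCoord_succ_two_mul t 0, mul_zero]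

theorem slimCoord_congr (t : ℕ) {m m' : ℤ} (h : (2 : ℤ) ^ t ∣ m - m') :
    slimCoord t m = slimCoord t m' := by
  cases t with
  | zero => rfl
  | succ t =>
    simp only [slimCoord]
    rw [normTrace_congr t h]
    congr 1
    refine Finset.sum_congr rfl fun i _ => normTrace_congr t ?_
    rwa [sub_sub_sub_cancel_right]

theorem slimCoord_add_half (t : ℕ) (m : ℤ) :
    slimCoord (t + 1) (m + 2 ^ t) = -slimCoord (t + 1) m := by
  simp only [slimCoord, normTrace_add_half, add_sub_right_comm, Finset.sum_neg_distrib, neg_add]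

theorem normTrace_mem (t : ℕ) (m : ℤ) : normTrace t m ∈ ({0, 1, -1} : Set ℚ) := by
  unfold normTrace
  split_ifs <;> simp

theorem slimCoord_mem (t : ℕ) (m : ℤ) : slimCoord t m ∈ ({0, 1, -1} : Set ℚ) := by
  induction t generalizing m with
  | zero => simp [slimCoord]
  | succ t ih =>
    rcases Int.even_or_odd' m with ⟨k, rfl | rfl⟩
    · rw [slimCoord_succ_two_mul]; exact ih k
    · cases t with
      | zero => rw [slimCoord_one]; split_ifs <;> simp
      | succ t => rw [slimCoord_of_odd t ⟨k, rfl⟩]; exact normTrace_mem _ _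

/-- The combinatorial form of the duality `Sp (ϑ* ϑ^ρ) = δ_{1,ρ}`, where `ρ : ζ ↦ ζ ^ r`. -/
theorem slimCoord_duality (t : ℕ) {r : ℤ} (hr : Odd r) :
    1 + ∑ i ∈ Finset.range t, (2 : ℚ) ^ (t - 1 - i) * slimCoord (t + 1) (r * 2 ^ i) =
      if (2 : ℤ) ^ (t + 1) ∣ r - 1 then 2 ^ t else 0 := by
  induction t with
  | zero =>
    have : (2 : ℤ) ∣ r - 1 := by obtain ⟨k, rfl⟩ := hr; omega
    simp [this]
  | succ t ih =>
    have h1 : ∀ i ∈ Finset.range t, (2 : ℚ) ^ (t + 1 - 1 - (i + 1)) *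
        slimCoord (t + 1 + 1) (r * 2 ^ (i + 1)) =
        (2 : ℚ) ^ (t - 1 - i) * slimCoord (t + 1) (r * 2 ^ i) := fun i _ => by
      rw [show r * 2 ^ (i + 1) = 2 * (r * 2 ^ i) by ring, slimCoord_succ_two_mul]
      congr 2
      omega
    rw [Finset.sum_range_succ', Finset.sum_congr rfl h1, ← add_assoc, ih, pow_zero, mul_one,
      slimCoord_of_odd t hr, normTrace]
    have h2 : (2 : ℤ) ^ (t + 2) ∣ r - 1 → (2 : ℤ) ^ (t + 1) ∣ r - 1 :=
      (pow_dvd_pow 2 (t + 1).le_succ).trans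
    have h3 : t + 1 - 1 - 0 = t := by omega
    -- By induction the terms `i ≥ 1` together with the leading 1 give `2 ^ t` or 0. The term `i =
    -- 0` is `2 ^ t`, `-2 ^ t` or 0, so it doubles this value, cancels it, or leaves 0.
    by_cases ha : (2 : ℤ) ^ (t + 1) ∣ r - 1 <;> by_cases hb : (2 : ℤ) ^ (t + 2) ∣ r - 1
    · simp only [ha, hb, if_true]; simp; ring
    · simp [ha, hb]
    · exact absurd (h2 hb) ha
    · simp [ha, hb]


/-! ## Automorphisms and traces of cyclotomic fields -/

theorem isPrimitiveRoot_zetaC (n : ℕ) [NeZero n] : IsPrimitiveRoot (zetaC n) n := by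
  have h : IsPrimitiveRoot ((zetaC n : Cyc n) : ℂ) n := by
    simpa [zetaC, zeta] using Complex.isPrimitiveRoot_exp n (NeZero.ne n)
  exact IsPrimitiveRoot.coe_submonoidClass_iff.mp h

instance isCyclotomicExtension_cyc (n : ℕ) [NeZero n] : IsCyclotomicExtension {n} ℚ (Cyc n) := by
  change IsCyclotomicExtension {n} ℚ (IntermediateField.adjoin ℚ {zeta n}).toSubalgebra
  rw [IntermediateField.adjoin_simple_toSubalgebra_of_isAlgebraic (isIntegral_zeta n).isAlgebraic]
  exact (Complex.isPrimitiveRoot_exp n (NeZero.ne n)).adjoin_isCyclotomicExtension ℚ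

theorem finrank_cyc (n : ℕ) [NeZero n] : Module.finrank ℚ (Cyc n) = n.totient :=
  IsCyclotomicExtension.finrank (Cyc n) (Polynomial.cyclotomic.irreducible_rat (NeZero.pos n))

instance isGalois_cyc (n : ℕ) [NeZero n] : IsGalois ℚ (Cyc n) :=
  IsCyclotomicExtension.isGalois {n} ℚ (Cyc n)

theorem galCyc_ext {n : ℕ} {σ τ : GalCyc n} (h : σ (zetaC n) = τ (zetaC n)) : σ = τ := by
  have h' : (σ : Cyc n →ₐ[ℚ] Cyc n) = τ := by
    apply IntermediateField.adjoin_algHom_ext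
    intro x hx
    rw [Set.mem_singleton_iff] at hx
    subst hx
    exact h
  exact AlgEquiv.coe_toAlgHom_injective h'

/-- The embedding of the Galois group into `(ℤ/n)ˣ` is onto because both groups have `φ(n)`
elements. -/
theorem exists_galCyc_zetaC (n : ℕ) [NeZero n] {s : ℕ} (hs : s.Coprime n) :
    ∃ σ : GalCyc n, σ (zetaC n) = zetaC n ^ s := by
  have hinj := (isPrimitiveRoot_zetaC n).autToPow_injective ℚ
  have hbij : Function.Bijective ((isPrimitiveRoot_zetaC n).autToPow ℚ) := by
    rw [Nat.bijective_iff_injective_and_card]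
    refine ⟨hinj, ?_⟩
    rw [IsGalois.card_aut_eq_finrank, finrank_cyc, Nat.card_eq_fintype_card,
      ZMod.card_units_eq_totient]
  obtain ⟨σ, hσ⟩ := hbij.2 (ZMod.unitOfCoprime s hs)
  refine ⟨σ, ?_⟩
  rw [← (isPrimitiveRoot_zetaC n).autToPow_spec ℚ σ, hσ, ZMod.coe_unitOfCoprime, ZMod.val_natCast,
    ← pow_eq_pow_mod _ (isPrimitiveRoot_zetaC n).pow_eq_one]

theorem galCyc_zetaC (n : ℕ) [NeZero n] (σ : GalCyc n) :
    ∃ s : ℕ, s.Coprime n ∧ σ (zetaC n) = zetaC n ^ s :=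
  ⟨_, ZMod.val_coe_unit_coprime _, ((isPrimitiveRoot_zetaC n).autToPow_spec ℚ σ).symm⟩

theorem zetaC_ne_zero (n : ℕ) [NeZero n] : zetaC n ≠ 0 :=
  (isPrimitiveRoot_zetaC n).ne_zero (NeZero.ne n)

theorem zetaC_zpow_eq (n : ℕ) [NeZero n] {a b : ℤ} (h : (n : ℤ) ∣ a - b) :
    zetaC n ^ a = zetaC n ^ b := by
  rw [← div_eq_one_iff_eq (zpow_ne_zero _ (zetaC_ne_zero n)), ← zpow_sub₀ (zetaC_ne_zero n)]
  exact ((isPrimitiveRoot_zetaC n).zpow_eq_one_iff_dvd _).mpr h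

theorem zetaC_zpow_half (t : ℕ) : zetaC (2 ^ (t + 1)) ^ ((2 : ℤ) ^ t) = -1 := by
  have h := isPrimitiveRoot_zetaC (2 ^ (t + 1))
  have h2 : IsPrimitiveRoot (zetaC (2 ^ (t + 1)) ^ 2 ^ t) 2 :=
    h.pow (by positivity) (by rw [pow_succ])
  rw [← h2.eq_neg_one_of_two_right]
  norm_cast

theorem totient_two_pow_succ (t : ℕ) : (2 ^ (t + 1)).totient = 2 ^ t := by
  simp [Nat.totient_prime_pow_succ Nat.prime_two]

theorem coprime_two_pow_of_odd (t : ℕ) {s : ℕ} (hs : Odd s) : s.Coprime (2 ^ t) :=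
  Nat.Coprime.pow_right _ (Nat.coprime_two_right.mpr hs)

theorem trace_one_cyc (n : ℕ) [NeZero n] : Algebra.trace ℚ (Cyc n) 1 = n.totient := by
  have : Module.Free ℚ (Cyc n) := Module.Free.of_divisionRing ℚ (Cyc n)
  have := Algebra.trace_algebraMap (R := ℚ) (S := Cyc n) 1
  rwa [map_one, finrank_cyc, nsmul_one] at this

theorem trace_zetaC_zpow (t : ℕ) (m : ℤ) :
    Algebra.trace ℚ (Cyc (2 ^ (t + 1))) (zetaC (2 ^ (t + 1)) ^ m) = 2 ^ t * normTrace t m := by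
  by_cases h1 : (2 : ℤ) ^ t ∣ m
  · by_cases h2 : (2 : ℤ) ^ (t + 1) ∣ m
    · rw [zetaC_zpow_eq (b := 0) _ (by simpa using h2), zpow_zero, trace_one_cyc,
        totient_two_pow_succ]
      simp [normTrace, h2]
    · have h3 : (2 : ℤ) ^ (t + 1) ∣ m - 2 ^ t := by
        obtain ⟨k, rfl⟩ := h1
        have hp : (2 : ℤ) ^ t ≠ 0 := by positivity
        rw [pow_succ, mul_dvd_mul_iff_left hp] at h2
        obtain ⟨l, hl⟩ : Odd k := by
          rwa [← Int.not_even_iff_odd, even_iff_two_dvd]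
        exact ⟨l, by rw [hl]; ring⟩
      rw [zetaC_zpow_eq (b := 2 ^ t) _ (by simpa using h3), zetaC_zpow_half, map_neg,
        trace_one_cyc, totient_two_pow_succ]
      simp [normTrace, h1, h2]
  · have hm : m ≠ 0 := by rintro rfl; simp at h1
    obtain ⟨a, k, hk, hmk⟩ : ∃ a : ℕ, ∃ k : ℤ, Odd k ∧ m = 2 ^ a * k := by
      obtain ⟨a, k, hk, hmk⟩ := Nat.exists_eq_two_pow_mul_odd (Int.natAbs_ne_zero.mpr hm)
      rcases Int.natAbs_eq m with h | h
      · exact ⟨a, k, by exact_mod_cast hk, by rw [h, hmk]; push_cast; ring⟩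
      · exact ⟨a, -k, Odd.neg (by exact_mod_cast hk), by rw [h, hmk]; push_cast; ring⟩
    have ha : a < t := by
      by_contra! h
      exact h1 (hmk ▸ (pow_dvd_pow 2 h).mul_right k)
    obtain ⟨b, rfl⟩ : ∃ b, t = a + (b + 1) := ⟨t - a - 1, by omega⟩
    -- With `m = 2 ^ a * k`, this automorphism adds `2 ^ t * k` to the exponent. As `k` is odd, it
    -- negates `ζ ^ m`, so the trace equals its own negative.
    obtain ⟨σ, hσ⟩ := exists_galCyc_zetaC (2 ^ (a + (b + 1) + 1)) (s := 1 + 2 ^ (b + 1))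
      (coprime_two_pow_of_odd _ ⟨2 ^ b, by ring⟩)
    have h2 : σ (zetaC (2 ^ (a + (b + 1) + 1)) ^ m) = -zetaC (2 ^ (a + (b + 1) + 1)) ^ m := by
      rw [map_zpow₀, hσ, ← zpow_natCast, ← zpow_mul, ← neg_one_mul, ← zetaC_zpow_half,
        ← zpow_add₀ (zetaC_ne_zero _)]
      apply zetaC_zpow_eq
      obtain ⟨l, rfl⟩ := hk
      exact ⟨l, by rw [hmk]; push_cast; ring⟩
    have h3 := Algebra.trace_eq_of_algEquiv σ (zetaC (2 ^ (a + (b + 1) + 1)) ^ m)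
    rw [h2, map_neg] at h3
    have h4 : ¬ (2 : ℤ) ^ (a + (b + 1) + 1) ∣ m := fun h =>
      h1 ((pow_dvd_pow 2 (Nat.le_succ _)).trans h)
    simp only [normTrace, h1, h4, if_false, mul_zero]
    linarith

/-! ## The generator and its dual -/

/-- `ϑ_n`, `n = 2 ^ t`, as an explicit element of `ℚ(ζ_n)`. -/
noncomputable def slimElt : (t : ℕ) → Cyc (2 ^ t)
  | 0 => 1
  | t + 1 => (1 / 2 ^ t : ℚ) • (1 + ∑ i ∈ Finset.range t,
      (2 ^ (t - 1 - i) : ℚ) • zetaC (2 ^ (t + 1)) ^ (2 ^ i : ℤ))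

/-- The dual generator of `slimElt`. -/
noncomputable def slimDual : (t : ℕ) → Cyc (2 ^ t)
  | 0 => 1
  | t + 1 => (1 / 2 ^ t : ℚ) • (1 + ∑ i ∈ Finset.range t,
      zetaC (2 ^ (t + 1)) ^ (-2 ^ i : ℤ))

/-- `slimCoord` is by construction this expansion: the factor `1 / 2 ^ t` of `slimDual` cancels the
degree `φ(n) = 2 ^ t`. -/
theorem trace_slimDual_mul_zpow (t : ℕ) (m : ℤ) :
    Algebra.trace ℚ (Cyc (2 ^ t)) (slimDual t * zetaC (2 ^ t) ^ m) = slimCoord t m := by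
  cases t with
  | zero =>
    have h1 : zetaC (2 ^ 0) = 1 := IsPrimitiveRoot.one_right_iff.mp (isPrimitiveRoot_zetaC (2 ^ 0))
    rw [h1, one_zpow, slimDual, mul_one, trace_one_cyc]
    simp [slimCoord]
  | succ t =>
    have h0 := zetaC_ne_zero (2 ^ (t + 1))
    have hp : (2 : ℚ) ^ t ≠ 0 := by positivity
    simp only [slimDual, slimCoord, smul_mul_assoc, add_mul, one_mul, Finset.sum_mul, map_smul,
      map_add, map_sum, ← zpow_add₀ h0, trace_zetaC_zpow, smul_eq_mul, ← Finset.mul_sum,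
      ← mul_add]
    rw [← mul_assoc, one_div_mul_cancel hp, one_mul]
    simp only [neg_add_eq_sub]

open Classical in
theorem trace_slimDual_mul_slimElt (t : ℕ) (ρ : GalCyc (2 ^ t)) :
    Algebra.trace ℚ (Cyc (2 ^ t)) (slimDual t * ρ (slimElt t)) = if 1 = ρ then 1 else 0 := by
  obtain ⟨r, hr, hρ⟩ := galCyc_zetaC (2 ^ t) ρ
  have hone : 1 = ρ ↔ (2 : ℤ) ^ t ∣ r - 1 := by
    constructor
    · rintro rfl
      have := ((isPrimitiveRoot_zetaC (2 ^ t)).zpow_eq_one_iff_dvd (r - 1)).mp (by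
        rw [zpow_sub₀ (zetaC_ne_zero _), zpow_natCast, ← hρ, zpow_one]
        exact div_self (zetaC_ne_zero _))
      simpa using this
    · intro h
      apply galCyc_ext
      rw [hρ, ← zpow_natCast, zetaC_zpow_eq (b := 1) _ (by simpa using h), zpow_one]
      rfl
  cases t with
  | zero =>
    have := trace_slimDual_mul_zpow 0 0
    rw [zpow_zero, mul_one] at this
    rw [slimElt, map_one, mul_one, this, if_pos (hone.mpr (by simp)), slimCoord]
  | succ t =>
    have hr' : Odd (r : ℤ) := by
      exact_mod_cast Nat.coprime_two_right.mp
        (Nat.Coprime.coprime_dvd_right (dvd_pow_self 2 t.succ_ne_zero) hr)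
    have hp : (2 : ℚ) ^ t ≠ 0 := by positivity
    have h1 := trace_slimDual_mul_zpow (t + 1) 0
    rw [slimCoord_zero_right, zpow_zero, mul_one] at h1
    have hρ' : ρ (zetaC (2 ^ (t + 1))) = zetaC (2 ^ (t + 1)) ^ (r : ℤ) := by
      rw [hρ, zpow_natCast]
    have hs : ∀ (c : ℚ) (x : Cyc (2 ^ (t + 1))), ρ (c • x) = c • ρ x :=
      fun c x => ρ.toLinearMap.map_smul c x
    simp only [slimElt, hs, map_smul, map_add, map_sum, map_one, map_zpow₀, hρ',
      ← zpow_mul, mul_smul_comm, mul_add, mul_one, Finset.mul_sum, trace_slimDual_mul_zpow, h1,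
      smul_eq_mul]
    rw [← Finset.mul_sum, ← mul_one_add, slimCoord_duality t hr']
    simp only [hone]
    split_ifs <;> simp [hp]

-- Pairing a linear relation among the conjugates of `θ` with `σ ψ` isolates the coefficient at `σ`;
-- spanning follows by counting dimensions.
open Classical in
theorem isNBG_of_trace_dual {n : ℕ} [NeZero n] {θ ψ : Cyc n}
    (h : ∀ ρ : GalCyc n,
      Algebra.trace ℚ (Cyc n) (ψ * ρ θ) = if 1 = ρ then 1 else 0) : IsNBG θ := by
  have hli : LinearIndependent ℚ (fun σ : GalCyc n => σ θ) := by
    rw [Fintype.linearIndependent_iff]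
    intro a ha σ
    have h1 : ∀ ρ : GalCyc n, Algebra.trace ℚ (Cyc n) (σ ψ * ρ θ) = if σ = ρ then 1 else 0 := by
      intro ρ
      have h2 : σ ψ * ρ θ = σ (ψ * (σ⁻¹ * ρ) θ) := by
        rw [map_mul]; congr 1; simp [AlgEquiv.mul_apply]
      rw [h2, Algebra.trace_eq_of_algEquiv σ, h]
      simp only [eq_comm (a := (1 : GalCyc n)), inv_mul_eq_one]
    have h3 : Algebra.trace ℚ (Cyc n) (σ ψ * ∑ ρ, a ρ • ρ θ) = 0 := by
      rw [ha, mul_zero, map_zero]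
    simpa [Finset.mul_sum, h1] using h3
  refine ⟨hli, (hli.span_eq_top_of_card_eq_finrank' ?_).ge⟩
  rw [← Nat.card_eq_fintype_card, IsGalois.card_aut_eq_finrank]

open Classical in
theorem dualGen_eq_of_trace {n : ℕ} {θ ψ : Cyc n} (hθ : IsNBG θ)
    (h : ∀ ρ : GalCyc n,
      Algebra.trace ℚ (Cyc n) (ψ * ρ θ) = if 1 = ρ then 1 else 0) : dualGen θ hθ = ψ := by
  rw [← sub_eq_zero]
  apply (traceForm_nondegenerate ℚ (Cyc n)).1
  suffices Algebra.traceForm ℚ (Cyc n) (dualGen θ hθ) = Algebra.traceForm ℚ (Cyc n) ψ by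
    intro y
    rw [map_sub, this, sub_self, LinearMap.zero_apply]
  refine (normalBasis θ hθ).ext fun ρ => ?_
  have h1 := trace_dualGen θ hθ 1 ρ
  simp only [normalBasis, Module.Basis.mk_apply, Algebra.traceForm_apply]
  rw [h, ← h1, AlgEquiv.one_apply]

theorem isNBG_slimElt (t : ℕ) : IsNBG (slimElt t) :=
  isNBG_of_trace_dual fun ρ => trace_slimDual_mul_slimElt t ρ

theorem dualGen_slimElt (t : ℕ) : dualGen (slimElt t) (isNBG_slimElt t) = slimDual t :=
  dualGen_eq_of_trace _ fun ρ => trace_slimDual_mul_slimElt t ρ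

theorem isSlim_slimElt (t : ℕ) : IsSlim (slimElt t) (isNBG_slimElt t) := fun s => by
  rw [dualGen_slimElt, trace_slimDual_mul_zpow]
  exact slimCoord_mem t s


/-! ## Gauss sums modulo powers of two -/

/-- A conductor may equal a level only propositionally; comparing characters on integers avoids
transport between the two types. -/
theorem gaussSum_stdAddChar_congr {a b : ℕ} [NeZero a] [NeZero b] (h : a = b)
    (χ : DirichletCharacter ℂ a) (ψ : DirichletCharacter ℂ b)
    (hχ : ∀ x : ℤ, χ (x : ZMod a) = ψ (x : ZMod b)) :
    gaussSum χ ZMod.stdAddChar = gaussSum ψ ZMod.stdAddChar := by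
  subst h
  congr 1
  ext u
  obtain ⟨x, hx⟩ := ZMod.intCast_surjective (u : ZMod a)
  rw [← hx, hχ]

theorem tau_changeLevel {n m : ℕ} [NeZero n] [NeZero m] (h : n ∣ m)
    (χ : DirichletCharacter ℂ n) : tau (DirichletCharacter.changeLevel h χ) = tau χ := by
  have : NeZero χ.conductor := ⟨χ.conductor_ne_zero⟩
  have : NeZero (DirichletCharacter.changeLevel h χ).conductor :=
    ⟨(DirichletCharacter.changeLevel h χ).conductor_ne_zero⟩
  exact gaussSum_stdAddChar_congr (χ.conductor_changeLevel h) _ _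
    (DirichletCharacter.primitiveCharacter_changeLevel_apply h χ)

theorem tau_eq_gaussSum_of_isPrimitive {n : ℕ} [NeZero n] {χ : DirichletCharacter ℂ n}
    (h : χ.IsPrimitive) : tau χ = gaussSum χ ZMod.stdAddChar := by
  have : NeZero χ.conductor := ⟨χ.conductor_ne_zero⟩
  refine gaussSum_stdAddChar_congr h _ _ fun x => ?_
  by_cases hx : IsCoprime x n
  · exact χ.primitiveCharacter_apply_of_isCoprime hx
  · have h' : χ.conductor = n := h
    rw [(DirichletCharacter.apply_eq_zero_iff ..).mpr hx,
      (DirichletCharacter.apply_eq_zero_iff ..).mpr (by rwa [h'])]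

/-- Orthogonality of characters leaves only the residue 1. The Gauss sums here are taken at level
`n`, without passing to primitive characters. -/
theorem sum_gaussSum_stdAddChar (n : ℕ) [NeZero n] :
    ∑ χ : DirichletCharacter ℂ n, gaussSum χ ZMod.stdAddChar = n.totient * zeta n := by
  simp only [gaussSum]
  rw [Finset.sum_comm]
  simp only [← Finset.sum_mul, DirichletCharacter.sum_characters_eq, ite_mul, zero_mul,
    Finset.sum_ite_eq', Finset.mem_univ, if_true]
  congr 1
  simpa [zeta] using ZMod.stdAddChar_coe (N := n) 1

theorem changeLevel_add_half (t : ℕ) (χ : DirichletCharacter ℂ (2 ^ (t + 1)))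
    (h : 2 ^ (t + 1) ∣ 2 ^ (t + 2)) (a : ℤ) :
    DirichletCharacter.changeLevel h χ ((a + 2 ^ (t + 1) : ℤ) : ZMod (2 ^ (t + 2))) =
      DirichletCharacter.changeLevel h χ (a : ZMod (2 ^ (t + 2))) := by
  have hc : ∀ b : ℤ, IsCoprime b ((2 ^ (t + 2) : ℕ) : ℤ) ↔ Odd b := fun b => by
    push_cast
    rw [IsCoprime.pow_right_iff (by omega), Int.isCoprime_two_right]
  have he : Even ((2 : ℤ) ^ (t + 1)) := ⟨2 ^ t, by ring⟩
  by_cases ha : Odd a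
  · rw [DirichletCharacter.changeLevel_eq_cast_of_dvd' _ _ ((hc _).mpr ha),
      DirichletCharacter.changeLevel_eq_cast_of_dvd' _ _ ((hc _).mpr (ha.add_even he))]
    congr 1
    rw [ZMod.intCast_eq_intCast_iff_dvd_sub]
    exact ⟨-1, by push_cast; ring⟩
  · rw [(DirichletCharacter.apply_eq_zero_iff ..).mpr (mt (hc _).mp ha),
      (DirichletCharacter.apply_eq_zero_iff ..).mpr (mt (hc _).mp ?_)]
    rw [Int.not_odd_iff_even] at ha ⊢
    exact ha.add he

theorem stdAddChar_half (t : ℕ) :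
    (ZMod.stdAddChar ((2 ^ t : ℤ) : ZMod (2 ^ (t + 1))) : ℂ) = -1 := by
  rw [ZMod.stdAddChar_coe, ← Complex.exp_pi_mul_I]
  congr 1
  push_cast
  field_simp
  ring

/-- Translating the summation variable by half the modulus fixes the induced character and negates
the additive one. The lower level has to be at least 2: the trivial character mod 2 has Gauss sum
`-1`. -/
theorem gaussSum_changeLevel_eq_zero (t : ℕ) (χ : DirichletCharacter ℂ (2 ^ (t + 1)))
    (h : 2 ^ (t + 1) ∣ 2 ^ (t + 2)) :
    gaussSum (DirichletCharacter.changeLevel h χ) ZMod.stdAddChar = 0 := by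
  have key : gaussSum (DirichletCharacter.changeLevel h χ) ZMod.stdAddChar =
      -gaussSum (DirichletCharacter.changeLevel h χ) ZMod.stdAddChar := by
    conv_lhs => rw [gaussSum,
      ← Equiv.sum_comp (Equiv.addRight ((2 ^ (t + 1) : ℤ) : ZMod (2 ^ (t + 2))))]
    rw [gaussSum, ← Finset.sum_neg_distrib]
    refine Finset.sum_congr rfl fun x _ => ?_
    obtain ⟨a, rfl⟩ := ZMod.intCast_surjective x
    rw [Equiv.coe_addRight]
    beta_reduce
    rw [AddChar.map_add_eq_mul, stdAddChar_half, ← Int.cast_add,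
      changeLevel_add_half]
    ring
  exact self_eq_neg.mp key

/-- The conductor is a power of two, so if it is not the full level it already divides `2 ^ t`. -/
theorem isPrimitive_of_notMem_range_changeLevel (t : ℕ) (h : 2 ^ t ∣ 2 ^ (t + 1))
    {χ : DirichletCharacter ℂ (2 ^ (t + 1))}
    (hχ : χ ∉ Set.range (DirichletCharacter.changeLevel (R := ℂ) h)) : χ.IsPrimitive := by
  obtain ⟨k, hk, hk'⟩ := (Nat.dvd_prime_pow Nat.prime_two).mp χ.conductor_dvd_level
  rw [DirichletCharacter.isPrimitive_def, hk']
  by_contra hne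
  have hkt : k ≤ t := by
    have : k ≠ t + 1 := fun h => hne (by rw [h])
    omega
  have h1 : χ.FactorsThrough (2 ^ t) :=
    (DirichletCharacter.mem_conductorSet_iff_conductor_dvd χ h).mpr (hk' ▸ pow_dvd_pow 2 hkt)
  exact hχ ⟨h1.χ₀, h1.eq_changeLevel.symm⟩

/-- For primitive characters `tau` is the Gauss sum at the full level; for induced ones that Gauss
sum is 0. Hence `tau χ - gaussSum χ` lives on the characters of the lower level, and the subtracted
total is `φ(n) ζ_n`. -/
theorem sum_tau_succ (t : ℕ) :
    ∑ χ : DirichletCharacter ℂ (2 ^ (t + 2)), tau χ =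
      ∑ χ : DirichletCharacter ℂ (2 ^ (t + 1)), tau χ + 2 ^ (t + 1) * zeta (2 ^ (t + 2)) := by
  have h : 2 ^ (t + 1) ∣ 2 ^ (t + 2) := pow_dvd_pow 2 (Nat.le_succ _)
  have h1 : ∑ χ : DirichletCharacter ℂ (2 ^ (t + 1)), tau χ =
      ∑ χ : DirichletCharacter ℂ (2 ^ (t + 2)), (tau χ - gaussSum χ ZMod.stdAddChar) := by
    refine Fintype.sum_of_injective (DirichletCharacter.changeLevel h)
      (DirichletCharacter.changeLevel_injective h) _ _ (fun χ hχ => ?_) fun χ => ?_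
    · rw [tau_eq_gaussSum_of_isPrimitive (isPrimitive_of_notMem_range_changeLevel _ h hχ),
        sub_self]
    · rw [gaussSum_changeLevel_eq_zero, tau_changeLevel, sub_zero]
  rw [h1, Finset.sum_sub_distrib, sum_gaussSum_stdAddChar, totient_two_pow_succ]
  push_cast
  ring

theorem tau_one (n : ℕ) [NeZero n] : tau (1 : DirichletCharacter ℂ n) = 1 := by
  rw [← DirichletCharacter.changeLevel_one (one_dvd n), tau_changeLevel,
    tau_eq_gaussSum_of_isPrimitive DirichletCharacter.isPrimitive_one_level_one, gaussSum]
  have h : ∀ x : ZMod 1, (1 : DirichletCharacter ℂ 1) x * ZMod.stdAddChar x = 1 := fun x => by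
    have h0 : x = 0 := Subsingleton.elim _ _
    have h1 : (1 : DirichletCharacter ℂ 1) x = 1 := by
      rw [Subsingleton.elim x 1, map_one]
    rw [h1, h0, AddChar.map_zero_eq_one, one_mul]
  simp [h]

theorem sum_tau_two_pow_succ (t : ℕ) :
    ∑ χ : DirichletCharacter ℂ (2 ^ (t + 1)), tau χ =
      1 + ∑ k ∈ Finset.range t, 2 ^ (k + 1) * zeta (2 ^ (k + 2)) := by
  induction t with
  | zero =>
    have h : ∀ χ : DirichletCharacter ℂ (2 ^ (0 + 1)), χ = 1 := fun χ => by
      ext u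
      have hu : u = 1 := by revert u; decide
      rw [hu, Units.val_one, map_one, map_one]
    rw [Finset.range_zero, Finset.sum_empty, add_zero, Fintype.sum_eq_single 1
      fun χ hχ => absurd (h χ) hχ, tau_one]
  | succ t ih => rw [sum_tau_succ, ih, Finset.sum_range_succ, add_assoc]

theorem slimGen_eq_sum (n : ℕ) [NeZero n] :
    slimGen n = 1 / (n.totient : ℂ) *
      (1 + 1 / 2 * (∑ χ : DirichletCharacter ℂ n, tau χ - 1)) := by
  classical
  rw [← Finset.sum_erase_add _ _ (Finset.mem_univ (1 : DirichletCharacter ℂ n)), tau_one,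
    add_sub_cancel_right, slimGen]

theorem zeta_pow_two_pow (k i : ℕ) : zeta (2 ^ (k + i)) ^ 2 ^ i = zeta (2 ^ k) := by
  rw [zeta, zeta, ← Complex.exp_nat_mul]
  congr 1
  push_cast
  rw [pow_add]
  field_simp

theorem coe_slimElt (t : ℕ) : (slimElt t : ℂ) = slimGen (2 ^ t) := by
  rw [slimGen_eq_sum]
  cases t with
  | zero =>
    have h : ∀ χ : DirichletCharacter ℂ (2 ^ 0), χ = 1 := fun χ =>
      DirichletCharacter.level_one' χ (pow_zero 2)
    rw [Fintype.sum_eq_single 1 fun χ hχ => absurd (h χ) hχ, tau_one]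
    simp [slimElt]
  | succ t =>
    rw [sum_tau_two_pow_succ, totient_two_pow_succ, add_sub_cancel_left,
      ← Finset.sum_range_reflect]
    -- The sum over levels is reversed, `k = t - 1 - i`, so that `ζ_{2^{k+2}}` becomes `ζ_n ^ 2 ^
    -- i`; the factor `1 / 2` lowers the weight to `2 ^ k`.
    have h1 : ∀ i ∈ Finset.range t, (1 / 2 : ℂ) * (2 ^ (t - 1 - i + 1) *
        zeta (2 ^ (t - 1 - i + 2))) = 2 ^ (t - 1 - i) * zeta (2 ^ (t + 1)) ^ 2 ^ i := by
      intro i hi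
      rw [Finset.mem_range] at hi
      have h2 : t + 1 = t - 1 - i + 2 + i := by omega
      rw [h2, zeta_pow_two_pow, pow_succ]
      ring
    rw [Finset.mul_sum, Finset.sum_congr rfl h1]
    have h3 : ((zetaC (2 ^ (t + 1)) : Cyc (2 ^ (t + 1))) : ℂ) = zeta (2 ^ (t + 1)) := rfl
    have h4 : ∀ i : ℕ, zetaC (2 ^ (t + 1)) ^ (2 ^ i : ℤ) = zetaC (2 ^ (t + 1)) ^ 2 ^ i :=
      fun i => by rw [← zpow_natCast]; norm_cast
    have h5 : ((2 : Cyc (2 ^ (t + 1))) : ℂ) = 2 := rfl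
    simp [slimElt, h3, h4, h5, Algebra.smul_def]


/-! ## Entries of the matrices -/

theorem matA_slimElt_apply (t : ℕ) (k l : Fin (2 ^ t)) :
    matA (slimElt t) (isNBG_slimElt t) k l = slimCoord t ((k : ℤ) * l) := by
  rw [matA, Matrix.of_apply, dualGen_slimElt, ← trace_slimDual_mul_zpow, ← zpow_natCast]
  push_cast
  rfl

/-- Since `ζ ^ l = σ (ζ ^ (r l))`, invariance of the trace removes `σ`. Any integer inverse `r` is
allowed, so one inverse mod `n` can also serve at level `n / 2`. -/
theorem matN_slimElt_apply (t : ℕ) (l : Fin (2 ^ t)) {σ : GalCyc (2 ^ (t + 1))} {s : ℕ} {r : ℤ}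
    (hσ : σ (zetaC (2 ^ (t + 1))) = zetaC (2 ^ (t + 1)) ^ s)
    (hr : (2 : ℤ) ^ (t + 1) ∣ s * r - 1) :
    matN (slimElt (t + 1)) (isNBG_slimElt (t + 1)) l σ = slimCoord (t + 1) (r * l) := by
  have h1 : zetaC (2 ^ (t + 1)) ^ (l : ℕ) = σ (zetaC (2 ^ (t + 1)) ^ (r * l)) := by
    rw [map_zpow₀, hσ, ← zpow_natCast, ← zpow_natCast, ← zpow_mul]
    refine zetaC_zpow_eq _ ?_
    rw [← dvd_neg]
    push_cast
    exact (hr.mul_right l).trans (dvd_of_eq (by ring))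
  rw [matN, Matrix.of_apply, dualGen_slimElt, h1, ← map_mul, Algebra.trace_eq_of_algEquiv σ,
    trace_slimDual_mul_zpow]

theorem exists_galEquiv (t : ℕ) : ∃ g : Fin (2 ^ t) ≃ GalCyc (2 ^ (t + 1)), ∀ j : Fin (2 ^ t),
    g j (zetaC (2 ^ (t + 1))) = zetaC (2 ^ (t + 1)) ^ (2 * (j : ℕ) + 1) := by
  choose f hf using fun j : Fin (2 ^ t) => exists_galCyc_zetaC (2 ^ (t + 1))
    (coprime_two_pow_of_odd (t + 1) (odd_two_mul_add_one (j : ℕ)))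
  have hbij : Function.Bijective f := by
    rw [Nat.bijective_iff_injective_and_card]
    constructor
    · intro i j hij
      have hi := i.isLt
      have hj := j.isLt
      have h := (isPrimitiveRoot_zetaC (2 ^ (t + 1))).pow_inj (i := 2 * i + 1) (j := 2 * j + 1)
        (by rw [pow_succ]; omega) (by rw [pow_succ]; omega) (by rw [← hf, ← hf, hij])
      exact Fin.ext (by omega)
    · rw [IsGalois.card_aut_eq_finrank, finrank_cyc, totient_two_pow_succ, Nat.card_fin]
  exact ⟨Equiv.ofBijective f hbij, hf⟩

/-- The bijection `j ↦ (ζ_n ↦ ζ_n ^ (2 j + 1))`, `n = 2 ^ (t + 1)`. -/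
noncomputable def galEquiv (t : ℕ) : Fin (2 ^ t) ≃ GalCyc (2 ^ (t + 1)) :=
  (exists_galEquiv t).choose

theorem galEquiv_zetaC (t : ℕ) (j : Fin (2 ^ t)) :
    galEquiv t j (zetaC (2 ^ (t + 1))) = zetaC (2 ^ (t + 1)) ^ (2 * (j : ℕ) + 1) :=
  (exists_galEquiv t).choose_spec j

/-- `A_n` for `n = 2 ^ t`. -/
noncomputable abbrev slimA (t : ℕ) : Matrix (Fin (2 ^ t)) (Fin (2 ^ t)) ℚ :=
  matA (slimElt t) (isNBG_slimElt t)

theorem slimA_apply (t : ℕ) (k l : Fin (2 ^ t)) :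
    slimA t k l = slimCoord t ((k : ℤ) * l) :=
  matA_slimElt_apply t k l

/-- `N_n` for `n = 2 ^ (t + 1)`, with ordered columns. -/
noncomputable abbrev slimN (t : ℕ) : Matrix (Fin (2 ^ t)) (Fin (2 ^ t)) ℚ :=
  (matN (slimElt (t + 1)) (isNBG_slimElt (t + 1))).submatrix id (galEquiv t)

theorem slimN_apply (t : ℕ) (l j : Fin (2 ^ t)) {r : ℤ}
    (hr : (2 : ℤ) ^ (t + 1) ∣ (2 * j + 1) * r - 1) :
    slimN t l j = slimCoord (t + 1) (r * l) :=
  matN_slimElt_apply t l (galEquiv_zetaC t j) (by push_cast; exact hr)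

theorem odd_of_two_pow_dvd_mul_sub_one {t : ℕ} {s r : ℤ}
    (h : (2 : ℤ) ^ (t + 1) ∣ s * r - 1) : Odd r := by
  have h2 : Even (s * r - 1) := even_iff_two_dvd.mpr ((dvd_pow_self 2 t.succ_ne_zero).trans h)
  rw [Int.even_sub_one, Int.not_even_iff_odd] at h2
  exact (Int.odd_mul.mp h2).2

theorem exists_inverse_mod_two_pow (t : ℕ) {s : ℤ} (hs : Odd s) :
    ∃ r : ℤ, (2 : ℤ) ^ t ∣ s * r - 1 := by
  obtain ⟨a, b, h⟩ : IsCoprime s (2 ^ t) := (Int.isCoprime_two_right.mpr hs).pow_right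
  exact ⟨a, -b, by linear_combination h⟩

theorem two_pow_dvd_mul_val_inv_sub_one (t j : ℕ) :
    (2 : ℤ) ^ (t + 1) ∣
      (2 * j + 1) * ((((2 * j + 1 : ℕ) : ZMod (2 ^ (t + 1)))⁻¹).val : ℤ) - 1 := by
  have h := ZMod.coe_mul_inv_eq_one (n := 2 ^ (t + 1)) (2 * j + 1)
    (coprime_two_pow_of_odd _ (odd_two_mul_add_one j))
  have h2 := (ZMod.intCast_zmod_eq_zero_iff_dvd
    ((2 * j + 1) * ((((2 * j + 1 : ℕ) : ZMod (2 ^ (t + 1)))⁻¹).val : ℤ) - 1)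
    (2 ^ (t + 1))).mp (by
      push_cast
      rw [ZMod.natCast_zmod_val]
      push_cast at h
      rw [h, sub_self])
  exact_mod_cast h2

/-! ## The factorisations -/

theorem halves_inl_val (t : ℕ) (k : Fin (2 ^ t)) : (halves t (Sum.inl k) : ℕ) = k := by
  simp [halves]

theorem halves_inr_val (t : ℕ) (k : Fin (2 ^ t)) : (halves t (Sum.inr k) : ℕ) = 2 ^ t + k := by
  simp [halves, add_comm]

theorem kronId_slimA_one (m : ℕ) :
    kronId (slimA 1) m = Matrix.fromBlocks 1 1 1 (-1) := by
  have h (i j : Fin (2 ^ 1)) : slimA 1 i j = if (2 : ℤ) ∣ (i : ℤ) * j then 1 else -1 := by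
    rw [slimA_apply, slimCoord_one]
  ext (i | i) (j | j) <;> by_cases hij : i = j <;>
    simp [kronId, Matrix.kroneckerMap_apply, Equiv.boolProdEquivSum, finTwoEquiv, h, hij]

/-- Passing from row `k` to row `k + n / 2` leaves even columns unchanged by periodicity and negates
odd ones. The column `s⁻¹` of the upper half is the column `σ_s` of `N_n`. -/
theorem slimA_factorisation (t : ℕ) :
    (slimA (t + 1)).submatrix (halves t) (colOrder t) =
      kronId (slimA 1) (2 ^ t) * Matrix.fromBlocks (slimA t) 0 0 (slimN t) := by
  rw [kronId_slimA_one, Matrix.fromBlocks_multiply]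
  simp only [Matrix.one_mul, Matrix.mul_zero, add_zero, zero_add, Matrix.neg_mul]
  have hcl (j : Fin (2 ^ t)) : ((colOrder t (Sum.inl j) : ℕ) : ℤ) = 2 * j := by
    change ((2 * (j : ℕ) : ℕ) : ℤ) = _
    push_cast
    rfl
  have hcr (j : Fin (2 ^ t)) : (2 : ℤ) ^ (t + 1) ∣
      (2 * j + 1) * ((colOrder t (Sum.inr j) : ℕ) : ℤ) - 1 :=
    two_pow_dvd_mul_val_inv_sub_one t j
  ext (k | k) (j | j)
  · rw [Matrix.submatrix_apply, Matrix.fromBlocks_apply₁₁, slimA_apply, slimA_apply,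
      halves_inl_val, hcl, mul_left_comm, slimCoord_succ_two_mul]
  · rw [Matrix.submatrix_apply, Matrix.fromBlocks_apply₁₂, slimA_apply,
      slimN_apply t k j (hcr j), halves_inl_val, mul_comm]
  · rw [Matrix.submatrix_apply, Matrix.fromBlocks_apply₂₁, slimA_apply, slimA_apply,
      halves_inr_val, hcl, mul_left_comm, slimCoord_succ_two_mul]
    exact slimCoord_congr t ⟨j, by push_cast; ring⟩
  · rw [Matrix.submatrix_apply, Matrix.fromBlocks_apply₂₂, slimA_apply,
      Matrix.neg_apply, slimN_apply t k j (hcr j), halves_inr_val, ← slimCoord_add_half]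
    -- The exponent moved by `2 ^ t * r` rather than `2 ^ t`; with `r = 2 c + 1` the excess `2 ^ (t
    -- + 1) * c` is a period.
    obtain ⟨c, hc⟩ := odd_of_two_pow_dvd_mul_sub_one (hcr j)
    exact slimCoord_congr _ ⟨c, by rw [hc]; push_cast; ring⟩

/-- Multiplication by the unit `s` turns `r l - 1` into `l - s` and preserves divisibility by powers
of two. -/
theorem normTrace_of_mul_inverse (t : ℕ) {s r l : ℤ} (hr : (2 : ℤ) ^ (t + 1) ∣ s * r - 1) :
    normTrace t (r * l - 1) = normTrace t (l - s) := by
  have key (u : ℕ) (hu : (2 : ℤ) ^ u ∣ s * r - 1) : (2 : ℤ) ^ u ∣ r * l - 1 ↔ 2 ^ u ∣ l - s := by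
    constructor
    · intro h
      have := (h.mul_left s).sub (hu.mul_right l)
      exact this.trans (dvd_of_eq (by ring))
    · intro h
      have := (h.mul_left r).add hu
      exact this.trans (dvd_of_eq (by ring))
  simp only [normTrace, key _ hr, key t ((pow_dvd_pow 2 t.le_succ).trans hr)]

theorem normTrace_two_mul_sub (t : ℕ) (k j : Fin (2 ^ t)) :
    normTrace (t + 1) ((2 * k + 1) - (2 * j + 1)) = (1 : Matrix (Fin (2 ^ t)) _ ℚ) k j := by
  rw [add_sub_add_right_eq_sub, ← mul_sub, normTrace_succ_two_mul, Matrix.one_apply]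
  split_ifs with h
  · rw [h, sub_self, normTrace_zero]
  · have h1 : ¬ (2 : ℤ) ^ t ∣ (k : ℤ) - j := fun hd => h <| Fin.ext <| by
      have hk : ((k : ℕ) : ℤ) < 2 ^ t := by exact_mod_cast k.isLt
      have hj : ((j : ℕ) : ℤ) < 2 ^ t := by exact_mod_cast j.isLt
      have := Int.eq_zero_of_abs_lt_dvd hd (by rw [abs_lt]; constructor <;> omega)
      omega
    have h2 : ¬ (2 : ℤ) ^ (t + 1) ∣ (k : ℤ) - j := fun hd =>
      h1 ((pow_dvd_pow 2 t.le_succ).trans hd)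
    rw [normTrace, if_neg h2, if_neg h1]

/-- Columns `s` and `s + n / 2` agree in even rows, which see `s` only mod `n / 2`. In an odd row
`l` the entry is `normTrace (l - s)`, a Kronecker delta that changes sign under `s ↦ s + n / 2`. -/
theorem slimN_factorisation (t : ℕ) :
    (slimN (t + 1)).submatrix (evenOdd t) (halves t) =
      Matrix.fromBlocks (slimN t) 0 0 (1 : Matrix (Fin (2 ^ t)) (Fin (2 ^ t)) ℚ) *
        kronId (slimA 1) (2 ^ t) := by
  rw [kronId_slimA_one, Matrix.fromBlocks_multiply]
  simp only [Matrix.mul_one, add_zero, zero_add, Matrix.mul_neg, neg_zero]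
  have hel (j : Fin (2 ^ t)) : ((evenOdd t (Sum.inl j) : ℕ) : ℤ) = 2 * j := by
    change ((2 * (j : ℕ) : ℕ) : ℤ) = _
    push_cast
    rfl
  have hor (j : Fin (2 ^ t)) : ((evenOdd t (Sum.inr j) : ℕ) : ℤ) = 2 * j + 1 := by
    change ((2 * (j : ℕ) + 1 : ℕ) : ℤ) = _
    push_cast
    rfl
  have hhl (j : Fin (2 ^ t)) : ((halves t (Sum.inl j) : ℕ) : ℤ) = j := by
    rw [halves_inl_val]
  have hhr (j : Fin (2 ^ t)) : ((halves t (Sum.inr j) : ℕ) : ℤ) = 2 ^ t + j := by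
    rw [halves_inr_val]; push_cast; rfl
  have hle : (2 : ℤ) ^ (t + 1) ∣ 2 ^ (t + 1 + 1) := pow_dvd_pow 2 (Nat.le_succ _)
  ext (k | k) (j | j)
  · obtain ⟨r, hr⟩ := exists_inverse_mod_two_pow (t + 2) (odd_two_mul_add_one (j : ℤ))
    rw [Matrix.submatrix_apply, Matrix.fromBlocks_apply₁₁,
      slimN_apply (t + 1) _ _ (r := r) (by rw [hhl]; exact hr),
      slimN_apply t k j (hle.trans hr), hel, mul_left_comm, slimCoord_succ_two_mul]
  · obtain ⟨r, hr⟩ := exists_inverse_mod_two_pow (t + 2)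
      (odd_two_mul_add_one (2 ^ t + j : ℤ))
    rw [Matrix.submatrix_apply, Matrix.fromBlocks_apply₁₂,
      slimN_apply (t + 1) _ _ (r := r) (by rw [hhr]; exact hr),
      slimN_apply t k j (r := r) ?_, hel, mul_left_comm, slimCoord_succ_two_mul]
    -- An inverse of `s + n / 2` mod `n` is an inverse of `s` mod `n / 2`.
    have := (hle.trans hr).sub (dvd_mul_right (2 ^ (t + 1)) r)
    exact this.trans (dvd_of_eq (by ring))
  · obtain ⟨r, hr⟩ := exists_inverse_mod_two_pow (t + 2) (odd_two_mul_add_one (j : ℤ))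
    rw [Matrix.submatrix_apply, Matrix.fromBlocks_apply₂₁,
      slimN_apply (t + 1) _ _ (r := r) (by rw [hhl]; exact hr), hor,
      slimCoord_of_odd t ((odd_of_two_pow_dvd_mul_sub_one hr).mul (odd_two_mul_add_one _)),
      normTrace_of_mul_inverse _ hr, normTrace_two_mul_sub]
  · obtain ⟨r, hr⟩ := exists_inverse_mod_two_pow (t + 2)
      (odd_two_mul_add_one (2 ^ t + j : ℤ))
    rw [Matrix.submatrix_apply, Matrix.fromBlocks_apply₂₂,
      slimN_apply (t + 1) _ _ (r := r) (by rw [hhr]; exact hr), hor,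
      slimCoord_of_odd t ((odd_of_two_pow_dvd_mul_sub_one hr).mul (odd_two_mul_add_one _)),
      normTrace_of_mul_inverse _ hr, Matrix.neg_apply, ← normTrace_two_mul_sub,
      ← normTrace_add_half]
    exact normTrace_congr _ ⟨-1, by ring⟩

/-! ## The algorithms -/

theorem run_wires {ι κ : Type} [Fintype κ] (f : κ → ι) (x : ι → ℚ) :
    (Net.wires f).run x = x ∘ f := rfl

theorem run_butterfly (m : ℕ) (x : Fin m ⊕ Fin m → ℚ) :
    (Net.butterfly m).run x = (kronId (slimA 1) m).mulVec x := by
  rw [kronId_slimA_one, Matrix.fromBlocks_mulVec]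
  ext (i | i)
  · simp [Net.butterfly, Net.run, Gate.eval]
  · simp [Net.butterfly, Net.run, Gate.eval, sub_eq_add_neg, Matrix.neg_mulVec]

theorem run_par {ι κ ι' κ' : Type} [Fintype ι] [Fintype ι'] {P : Net ι κ} {Q : Net ι' κ'}
    {M : Matrix κ ι ℚ} {M' : Matrix κ' ι' ℚ} (hP : ∀ x, P.run x = M.mulVec x)
    (hQ : ∀ x, Q.run x = M'.mulVec x) (x : ι ⊕ ι' → ℚ) :
    (Net.par P Q).run x = (Matrix.fromBlocks M 0 0 M').mulVec x := by
  rw [Matrix.fromBlocks_mulVec]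
  simp [Net.run, hP, hQ]

/-- The initial wires realise the column order and the final ones undo the row order, so the network
evaluates the factorisation with its permutations removed. -/
theorem run_netN (t : ℕ) (x : Fin (2 ^ t) → ℚ) : (netN t).run x = (slimN t).mulVec x := by
  induction t with
  | zero =>
    have h (i j : Fin (2 ^ 0)) : slimN 0 i j = 1 := by
      have hi : (i : ℕ) = 0 := by have := i.isLt; omega
      rw [slimN_apply 0 i j (r := 1) (by simp), hi]
      simp [slimCoord_one]
    ext i
    rw [netN, run_wires, Matrix.mulVec, dotProduct,
      Fintype.sum_eq_single i fun j hj => absurd (Subsingleton.elim (α := Fin 1) j i) hj, h, one_mul]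
    rfl
  | succ t ih =>
    have hid (y : Fin (2 ^ t) → ℚ) : (Net.wires id).run y =
        (1 : Matrix (Fin (2 ^ t)) (Fin (2 ^ t)) ℚ).mulVec y := by
      rw [run_wires, Matrix.one_mulVec, Function.comp_id]
    simp only [netN, Net.run]
    rw [run_wires, run_wires, run_butterfly]
    rw [← Net.run, run_par ih hid, Matrix.mulVec_mulVec, ← slimN_factorisation,
      Matrix.submatrix_mulVec_equiv]
    ext i
    simp [Function.comp_def]

theorem run_netA (t : ℕ) (x : Fin (2 ^ t) → ℚ) : (netA t).run x = (slimA t).mulVec x := by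
  induction t with
  | zero =>
    have h (i j : Fin (2 ^ 0)) : slimA 0 i j = 1 := by
      rw [slimA_apply, slimCoord]
    ext i
    rw [netA, run_wires, Matrix.mulVec, dotProduct,
      Fintype.sum_eq_single i fun j hj => absurd (Subsingleton.elim (α := Fin 1) j i) hj, h, one_mul]
    rfl
  | succ t ih =>
    simp only [netA, Net.run]
    rw [run_wires, run_wires, run_butterfly]
    rw [← Net.run, run_par ih (run_netN t), Matrix.mulVec_mulVec, ← slimA_factorisation,
      show colIndex t = colOrder t from rfl, Matrix.submatrix_mulVec_equiv]
    ext i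
    simp [Function.comp_def]

/-! ### Operation counts -/

theorem cost_wires {ι κ : Type} [Fintype κ] (f : κ → ι) : (Net.wires f).cost = 0 := by
  simp [Net.wires, Net.cost, Gate.cost]

theorem cost_butterfly (m : ℕ) : (Net.butterfly m).cost = 2 * m := by
  simp [Net.butterfly, Net.cost, Gate.cost, two_mul]

theorem cost_netN_succ (t : ℕ) : (netN (t + 1)).cost = (netN t).cost + 2 ^ (t + 1) := by
  simp only [netN, Net.cost, cost_wires, cost_butterfly]
  ring

theorem cost_netN (t : ℕ) : (netN t).cost + 2 = 2 ^ (t + 1) := by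
  induction t with
  | zero => rw [netN, cost_wires]; rfl
  | succ t ih => rw [cost_netN_succ, add_right_comm, ih]; ring

theorem cost_netA_succ (t : ℕ) :
    (netA (t + 1)).cost = (netA t).cost + (netN t).cost + 2 ^ (t + 1) := by
  simp only [netA, Net.cost, cost_wires, cost_butterfly]
  ring

/-- The constant 4 closes the induction: `4 * 2 ^ t + (2 ^ (t + 1) - 2) + 2 ^ (t + 1) ≤ 4 * 2 ^ (t +
1)`. -/
theorem cost_netA_le (t : ℕ) : (netA t).cost ≤ 4 * 2 ^ t := by
  induction t with
  | zero => rw [netA, cost_wires]; exact Nat.zero_le _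
  | succ t ih =>
    have h := cost_netN t
    rw [cost_netA_succ]
    rw [pow_succ] at h ⊢
    omega

end SlimADFT

theorem mainTheorem2 :
    ∃ (θ : ∀ t : ℕ, SlimADFT.Cyc (2 ^ t)) (hθ : ∀ t : ℕ, SlimADFT.IsNBG (θ t))
      (g : ∀ t : ℕ, Fin (2 ^ t) ≃ SlimADFT.GalCyc (2 ^ (t + 1))),
      -- `θ t` is the element `ϑ_n` for `n = 2 ^ t`, and it generates a slim normal basis
      (∀ t : ℕ, (θ t : ℂ) = SlimADFT.slimGen (2 ^ t)) ∧
      (∀ t : ℕ, SlimADFT.IsSlim (θ t) (hθ t)) ∧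
      -- `g t` lists the automorphisms `ζ_n ↦ ζ_n ^ s`, `s = 1, 3, …, n - 1`, for `n = 2 ^ (t + 1)`
      (∀ (t : ℕ) (j : Fin (2 ^ t)),
        g t j (SlimADFT.zetaC (2 ^ (t + 1))) = SlimADFT.zetaC (2 ^ (t + 1)) ^ (2 * (j : ℕ) + 1)) ∧
      -- the recursive factorisation of `A_n`, `n = 2 ^ (t + 1)`
      (∀ t : ℕ,
        (SlimADFT.matA (θ (t + 1)) (hθ (t + 1))).submatrix
            (SlimADFT.halves t) (SlimADFT.colOrder t) =
          SlimADFT.kronId (SlimADFT.matA (θ 1) (hθ 1)) (2 ^ t) *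
            Matrix.fromBlocks (SlimADFT.matA (θ t) (hθ t)) 0
              0 ((SlimADFT.matN (θ (t + 1)) (hθ (t + 1))).submatrix id (g t))) ∧
      -- the recursive factorisation of `N_n`, `n = 2 ^ (t + 2)`
      (∀ t : ℕ,
        (SlimADFT.matN (θ (t + 2)) (hθ (t + 2))).submatrix
            (SlimADFT.evenOdd t) ((SlimADFT.halves t).trans (g (t + 1))) =
          Matrix.fromBlocks ((SlimADFT.matN (θ (t + 1)) (hθ (t + 1))).submatrix id (g t)) 0
              0 (1 : Matrix (Fin (2 ^ t)) (Fin (2 ^ t)) ℚ) *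
            SlimADFT.kronId (SlimADFT.matA (θ 1) (hθ 1)) (2 ^ t)) ∧
      -- the resulting algorithms compute the transform and the base change
      (∀ (t : ℕ) (x : Fin (2 ^ t) → ℚ),
        (SlimADFT.netA t).run x = SlimADFT.adft (θ t) (hθ t) x) ∧
      (∀ (t : ℕ) (x : Fin (2 ^ t) → ℚ),
        (SlimADFT.netN t).run x =
          ((SlimADFT.matN (θ (t + 1)) (hθ (t + 1))).submatrix id (g t)).mulVec x) ∧
      -- the number of additions
      (∀ t : ℕ, (SlimADFT.netN (t + 1)).cost = (SlimADFT.netN t).cost + 2 ^ (t + 2) / 2) ∧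
      (∀ t : ℕ, (SlimADFT.netN t).cost + 2 ≤ 2 ^ (t + 1)) ∧
      (∀ t : ℕ, (SlimADFT.netA (t + 1)).cost =
        (SlimADFT.netA t).cost + (SlimADFT.netN t).cost + 2 ^ (t + 1)) ∧
      (∃ C : ℕ, ∀ t : ℕ, (SlimADFT.netA t).cost ≤ C * 2 ^ t) := by
  refine ⟨SlimADFT.slimElt, SlimADFT.isNBG_slimElt, SlimADFT.galEquiv, SlimADFT.coe_slimElt,
    SlimADFT.isSlim_slimElt, SlimADFT.galEquiv_zetaC, SlimADFT.slimA_factorisation,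
    SlimADFT.slimN_factorisation, fun t x => ?_, SlimADFT.run_netN, fun t => ?_,
    fun t => (SlimADFT.cost_netN t).le, SlimADFT.cost_netA_succ, 4, SlimADFT.cost_netA_le⟩
  · rw [SlimADFT.run_netA, SlimADFT.adft, Matrix.toLin'_apply]
  · rw [SlimADFT.cost_netN_succ, pow_succ 2 (t + 1), Nat.mul_div_cancel _ two_pos]
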